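/- Let $P$ be a Borel probability measure on $\mathbb{R}^d$, fix $x\in\mathbb{R}^d$ and $m\in(0,1)$, and let $X_1,X_2,\dots$ be independent random vectors with law $P$. For a nondecreasing function $F$ write $F^{-1}(u)=\inf\{t\in\mathbb{R}: F(t)\ge u\}$. For a probability measure $Q$ on $\mathbb{R}^d$, define the distance to the measure $Q$ at resolution $m$ by $$\delta_{Q,m}(x)=\sqrt{\frac1m\int_0^m \bigl(G_{Q,x}^{-1}(u)\bigr)^2\,du},\qquad G_{Q,x}(t)=Q\bigl(\{y:\|y-x\|\le t\}\bigr).$$ Put $\delta(x)=\delta_{P,m}(x)$ and $\widehat\delta_n(x)=\delta_{P_n,m}(x)$, where $P_n$ is the empirical measure, which puts mass $1/n$ on each of $X_1,\dots,X_n$. Let $F_x(t)=P(\{y:\|y-x\|^2\le t\})$, and assume that $F_x$ is differentiable at $F_x^{-1}(m)$ with positive derivative there. Let $$\sigma_x^2=\frac1{m^2}\int_0^{F_x^{-1}(m)}\int_0^{F_x^{-1}(m)}\bigl[F_x(s\wedge t)-F_x(s)F_x(t)\bigr]\,ds\,dt .$$ Then $\sigma_x^2\ge 0$ and, as $n\to\infty$,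 $\sqrt n\,\bigl(\widehat\delta_n^{\,2}(x)-\delta^2(x)\bigr)$ converges in distribution to the normal law $N(0,\sigma_x^2)$. -/

import Mathlib

open MeasureTheory ProbabilityTheory Filter
open scoped ENNReal

noncomputable section

namespace DistToMeasure

/-- The generalized inverse `F⁻¹(u) = inf {t : F t ≥ u}` of a distribution function. -/
def quantile (F : ℝ → ℝ) (u : ℝ) : ℝ := sInf {t : ℝ | u ≤ F t}

/-- `G_x(t) = P(‖X - x‖ ≤ t)` for `X ∼ P`. -/
def distCDF {d : ℕ} (P : Measure (EuclideanSpace ℝ (Fin d)))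
    (x : EuclideanSpace ℝ (Fin d)) (t : ℝ) : ℝ :=
  P.real {y | ‖y - x‖ ≤ t}

/-- `F_x(t) = P(‖X - x‖² ≤ t)` for `X ∼ P`. -/
def sqDistCDF {d : ℕ} (P : Measure (EuclideanSpace ℝ (Fin d)))
    (x : EuclideanSpace ℝ (Fin d)) (t : ℝ) : ℝ :=
  P.real {y | ‖y - x‖ ^ 2 ≤ t}

/-- The distance to the measure `P` at resolution `m`:
`δ_{P,m}(x) = √((1/m) ∫₀^m (G_x⁻¹(u))² du)`. -/
def dtm {d : ℕ} (P : Measure (EuclideanSpace ℝ (Fin d))) (m : ℝ)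
    (x : EuclideanSpace ℝ (Fin d)) : ℝ :=
  √((1 / m) * ∫ u in (0 : ℝ)..m, (quantile (distCDF P x) u) ^ 2)

/-- The measure that puts mass `1/n` on each of the points `y₀, …, y_{n-1}`. -/
def empiricalMeasure {d n : ℕ} (y : Fin n → EuclideanSpace ℝ (Fin d)) :
    Measure (EuclideanSpace ℝ (Fin d)) :=
  (n : ℝ≥0∞)⁻¹ • ∑ i, Measure.dirac (y i)

/-- `σ_x² = m⁻² ∫₀^q ∫₀^q (F_x(s ∧ t) - F_x(s) F_x(t)) ds dt`, where `q = F_x⁻¹(m)`. -/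
def asympVariance {d : ℕ} (P : Measure (EuclideanSpace ℝ (Fin d))) (m : ℝ)
    (x : EuclideanSpace ℝ (Fin d)) : ℝ :=
  (1 / m ^ 2) * ∫ t in (0 : ℝ)..quantile (sqDistCDF P x) m,
    ∫ s in (0 : ℝ)..quantile (sqDistCDF P x) m,
      (sqDistCDF P x (min s t) - sqDistCDF P x s * sqDistCDF P x t)

end DistToMeasure

end

/-! ### Quantiles of the squared distance. -/

namespace DistToMeasure

variable {d : ℕ}

variable (Q : Measure (EuclideanSpace ℝ (Fin d))) (x : EuclideanSpace ℝ (Fin d))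

/-! Let F_Q be the law of ‖y - x‖² under Q, q_Q its m-quantile, and q = q_P. Since squaring turns
one quantile into the other, Fubini gives m δ_Q² = ∫₀^{q_Q} (m - F_Q). Cutting at the fixed level q
leaves m q - ∫₀^q F_Q, which is affine in Q, plus a remainder over [q, q_Q] (`dtm_sq_eq_add`).

For Q = P_n the affine part is an average of the bounded i.i.d. variables -(1/m) max(q - ‖X_i - x‖²,
0), up to a constant, so the classical CLT applies. A second use of Fubini identifies their variance
with σ² (`asympVariance_eq`), hence σ² ≥ 0.

By monotonicity the remainder is at most |q_Q - q| |F_Q(q) - m|. Differentiability gives F_P(q) = m,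
so √n (F_{P_n}(q) - m) is bounded in probability by Chebyshev. The positive derivative makes the
m-quantile unique, so q_{P_n} → q in probability. The product is negligible, and Slutsky's lemma
concludes. -/

lemma sqDistCDF_nonneg (t : ℝ) : 0 ≤ sqDistCDF Q x t := measureReal_nonneg

lemma sqDistCDF_of_neg {t : ℝ} (ht : t < 0) : sqDistCDF Q x t = 0 := by
  have : {y : EuclideanSpace ℝ (Fin d) | ‖y - x‖ ^ 2 ≤ t} = ∅ := by
    ext y
    simpa using ht.trans_le (by positivity)
  simp [sqDistCDF, this]

lemma measurableSet_sqDist_le (t : ℝ) :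
    MeasurableSet {y : EuclideanSpace ℝ (Fin d) | ‖y - x‖ ^ 2 ≤ t} :=
  measurableSet_le (by fun_prop) measurable_const

lemma integral_indicator_sqDist_le (t : ℝ) :
    ∫ y, {y | ‖y - x‖ ^ 2 ≤ t}.indicator 1 y ∂Q = sqDistCDF Q x t :=
  integral_indicator_one (measurableSet_sqDist_le x t)

variable [IsProbabilityMeasure Q]

lemma sqDistCDF_eq_cdf :
    sqDistCDF Q x = cdf (Q.map fun y ↦ ‖y - x‖ ^ 2) := by
  have : IsProbabilityMeasure (Q.map fun y ↦ ‖y - x‖ ^ 2) :=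
    Measure.isProbabilityMeasure_map (by fun_prop)
  ext t
  rw [cdf_eq_real, map_measureReal_apply (by fun_prop) measurableSet_Iic]
  rfl

lemma sqDistCDF_mono : Monotone (sqDistCDF Q x) := by
  rw [sqDistCDF_eq_cdf]
  exact monotone_cdf _

lemma intervalIntegrable_sqDistCDF (a b : ℝ) :
    IntervalIntegrable (sqDistCDF Q x) volume a b :=
  (sqDistCDF_mono Q x).intervalIntegrable

/-- The Galois connection between a distribution function and its generalized inverse. -/
lemma quantile_le_iff {u : ℝ} (hu : u ∈ Set.Ioo (0 : ℝ) 1) (t : ℝ) :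
    quantile (sqDistCDF Q x) u ≤ t ↔ u ≤ sqDistCDF Q x t := by
  have hmono := sqDistCDF_mono Q x
  have hbdd : BddBelow {t : ℝ | u ≤ sqDistCDF Q x t} := by
    refine ⟨0, fun s hs ↦ le_of_not_gt fun hs0 ↦ ?_⟩
    rw [Set.mem_ofPred_eq, sqDistCDF_of_neg Q x hs0] at hs
    exact hu.1.not_ge hs
  have hne : {t : ℝ | u ≤ sqDistCDF Q x t}.Nonempty := by
    have h : Tendsto (sqDistCDF Q x) atTop (nhds 1) := by
      rw [sqDistCDF_eq_cdf]
      exact tendsto_cdf_atTop _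
    obtain ⟨s, hs⟩ := (h.eventually (lt_mem_nhds hu.2)).exists
    exact ⟨s, hs.le⟩
  refine ⟨fun h ↦ ?_, fun h ↦ csInf_le hbdd h⟩
  -- Right-continuity is what makes the infimum attained.
  have hright : ContinuousWithinAt (sqDistCDF Q x) (Set.Ioi t) t := by
    rw [sqDistCDF_eq_cdf]
    exact ((cdf _).right_continuous t).mono Set.Ioi_subset_Ici_self
  refine ge_of_tendsto hright ?_
  filter_upwards [self_mem_nhdsWithin] with s hs
  obtain ⟨r, hr, hrs⟩ := exists_lt_of_csInf_lt hne (h.trans_lt hs)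
  exact le_trans hr (hmono hrs.le)

lemma lt_quantile_iff {u : ℝ} (hu : u ∈ Set.Ioo (0 : ℝ) 1) (t : ℝ) :
    t < quantile (sqDistCDF Q x) u ↔ sqDistCDF Q x t < u := by
  rw [← not_le, quantile_le_iff Q x hu, not_le]

lemma quantile_nonneg {u : ℝ} (hu : u ∈ Set.Ioo (0 : ℝ) 1) :
    0 ≤ quantile (sqDistCDF Q x) u := by
  by_contra! h
  have := (quantile_le_iff Q x hu _).1 le_rfl
  rw [sqDistCDF_of_neg Q x h] at this
  exact hu.1.not_ge this

lemma le_distCDF_iff {u : ℝ} (hu : u ∈ Set.Ioo (0 : ℝ) 1) (t : ℝ) :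
    u ≤ distCDF Q x t ↔ √(quantile (sqDistCDF Q x) u) ≤ t := by
  rcases lt_or_ge t 0 with ht | ht
  · have : {y : EuclideanSpace ℝ (Fin d) | ‖y - x‖ ≤ t} = ∅ := by
      ext y
      simpa using ht.trans_le (norm_nonneg _)
    simp only [distCDF, this, measureReal_empty]
    exact iff_of_false hu.1.not_ge fun h ↦ (ht.trans_le (Real.sqrt_nonneg _)).not_ge h
  · have : {y : EuclideanSpace ℝ (Fin d) | ‖y - x‖ ≤ t} = {y | ‖y - x‖ ^ 2 ≤ t ^ 2} := by
      ext y
      exact (pow_le_pow_iff_left₀ (norm_nonneg _) ht two_ne_zero).symm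
    rw [Real.sqrt_le_left ht, quantile_le_iff Q x hu, distCDF, this]
    rfl

lemma quantile_distCDF_sq {u : ℝ} (hu : u ∈ Set.Ioo (0 : ℝ) 1) :
    quantile (distCDF Q x) u ^ 2 = quantile (sqDistCDF Q x) u := by
  have : {t : ℝ | u ≤ distCDF Q x t} = Set.Ici √(quantile (sqDistCDF Q x) u) := by
    ext t
    exact le_distCDF_iff Q x hu t
  rw [quantile, this, csInf_Ici, Real.sq_sqrt (quantile_nonneg Q x hu)]

/-! ### Fubini formula and linearization. -/

/-- Both sides are the area of {(u, s) : 0 < u ≤ m, 0 < s < q, F s < u}, sliced in the two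
directions; the Galois connection describes the slices. -/
lemma integral_quantile {m : ℝ} (hm : m ∈ Set.Ioo (0 : ℝ) 1) :
    ∫ u in (0 : ℝ)..m, quantile (sqDistCDF Q x) u
      = ∫ s in (0 : ℝ)..quantile (sqDistCDF Q x) m, (m - sqDistCDF Q x s) := by
  set F := sqDistCDF Q x with hF
  set q := quantile F m with hq
  have hq0 : 0 ≤ q := quantile_nonneg Q x hm
  have hFmeas : Measurable F := (sqDistCDF_mono Q x).measurable
  have hint : Integrable (Function.uncurry fun u s : ℝ ↦ if F s < u then (1 : ℝ) else 0)
      ((volume.restrict (Set.Ioc 0 m)).prod (volume.restrict (Set.Ioo 0 q))) := by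
    refine Integrable.of_bound (C := 1) ?_ (ae_of_all _ fun p ↦ ?_)
    · exact (Measurable.ite (measurableSet_lt (hFmeas.comp measurable_snd) measurable_fst)
        measurable_const measurable_const).aestronglyMeasurable
    · simp only [Function.uncurry]
      split_ifs <;> simp
  rw [intervalIntegral.integral_of_le hm.1.le, intervalIntegral.integral_of_le hq0,
    integral_Ioc_eq_integral_Ioo (μ := volume) (x := (0 : ℝ)) (y := q)]
  calc ∫ u in Set.Ioc 0 m, quantile F u
      = ∫ u in Set.Ioc 0 m, ∫ s in Set.Ioo 0 q, if F s < u then (1 : ℝ) else 0 := by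
        refine setIntegral_congr_fun measurableSet_Ioc fun u hu ↦ ?_
        have hu' : u ∈ Set.Ioo (0 : ℝ) 1 := ⟨hu.1, hu.2.trans_lt hm.2⟩
        have huq : quantile F u ≤ q :=
          (quantile_le_iff Q x hu' q).2 (hu.2.trans ((quantile_le_iff Q x hm q).1 le_rfl))
        have hset : {s | F s < u} ∩ Set.Ioo 0 q = Set.Ioo 0 (quantile F u) := by
          ext s
          simp only [Set.mem_inter_iff, Set.mem_ofPred_eq, Set.mem_Ioo, hF,
            ← lt_quantile_iff Q x hu' s]
          exact ⟨fun h ↦ ⟨h.2.1, h.1⟩, fun h ↦ ⟨h.2, h.1, h.2.trans_le huq⟩⟩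
        have := integral_indicator_one (μ := volume.restrict (Set.Ioo 0 q))
          (measurableSet_lt hFmeas (measurable_const (a := u)))
        simp only [Set.indicator_apply, Set.mem_ofPred_eq, Pi.one_apply] at this
        rw [this, measureReal_restrict_apply (measurableSet_lt hFmeas measurable_const), hset,
          Real.volume_real_Ioo_of_le (quantile_nonneg Q x hu'), sub_zero]
    _ = ∫ s in Set.Ioo 0 q, ∫ u in Set.Ioc 0 m, if F s < u then (1 : ℝ) else 0 :=
        integral_integral_swap hint
    _ = ∫ s in Set.Ioo 0 q, (m - F s) := by
        refine setIntegral_congr_fun measurableSet_Ioo fun s hs ↦ ?_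
        have hsm : F s < m := (lt_quantile_iff Q x hm s).1 hs.2
        have h0 : 0 ≤ F s := sqDistCDF_nonneg Q x s
        have hset : Set.Ioi (F s) ∩ Set.Ioc 0 m = Set.Ioc (F s) m := by
          ext u
          simp only [Set.mem_inter_iff, Set.mem_Ioi, Set.mem_Ioc]
          exact ⟨fun h ↦ ⟨h.1, h.2.2⟩, fun h ↦ ⟨h.1, h0.trans_lt h.1, h.2⟩⟩
        have := integral_indicator_one (μ := volume.restrict (Set.Ioc 0 m))
          (measurableSet_Ioi (a := F s))
        simp only [Set.indicator_apply, Set.mem_Ioi, Pi.one_apply] at this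
        rw [this, measureReal_restrict_apply measurableSet_Ioi, hset,
          Real.volume_real_Ioc_of_le hsm.le]

lemma dtm_sq {m : ℝ} (hm : m ∈ Set.Ioo (0 : ℝ) 1) :
    dtm Q m x ^ 2
      = (1 / m) * ∫ s in (0 : ℝ)..quantile (sqDistCDF Q x) m, (m - sqDistCDF Q x s) := by
  rw [dtm, Real.sq_sqrt, ← integral_quantile Q x hm]
  · congr 1
    rw [intervalIntegral.integral_of_le hm.1.le, intervalIntegral.integral_of_le hm.1.le]
    refine setIntegral_congr_fun measurableSet_Ioc fun u hu ↦ ?_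
    exact quantile_distCDF_sq Q x ⟨hu.1, hu.2.trans_lt hm.2⟩
  · exact mul_nonneg (one_div_nonneg.2 hm.1.le)
      (intervalIntegral.integral_nonneg (μ := volume) hm.1.le fun u _ ↦ sq_nonneg _)

/-- The remainder in the linearization of the squared distance to a measure at the level `q`. -/
lemma abs_integral_sub_sqDistCDF_le {m : ℝ} (hm : m ∈ Set.Ioo (0 : ℝ) 1) (q : ℝ) :
    |∫ s in q..quantile (sqDistCDF Q x) m, (m - sqDistCDF Q x s)|
      ≤ |quantile (sqDistCDF Q x) m - q| * |sqDistCDF Q x q - m| := by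
  have hmono := sqDistCDF_mono Q x
  rw [mul_comm]
  rw [← Real.norm_eq_abs]
  refine intervalIntegral.norm_integral_le_of_norm_le_const_ae ?_
  -- The distribution function may jump over `m` at its own quantile, where the bound could fail;
  -- this null set is discarded.
  have hne : ∀ᵐ s : ℝ, s ≠ quantile (sqDistCDF Q x) m := by simp [ae_iff]
  filter_upwards [hne] with s hs hmem
  rw [Real.norm_eq_abs, abs_sub_comm]
  rcases Set.mem_uIoc.1 hmem with h | h
  · have hlt := (lt_quantile_iff Q x hm s).1 (lt_of_le_of_ne h.2 hs)
    have := hmono h.1.le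
    rw [abs_of_neg (by linarith), abs_of_neg (by linarith)]
    linarith
  · have hge := (quantile_le_iff Q x hm s).1 h.1.le
    have := hmono h.2
    rw [abs_of_nonneg (by linarith), abs_of_nonneg (by linarith)]
    linarith

/-- The level `q` is free: the quantile of P gives the expansion, while the quantile of `Q` itself
kills the last integral. -/
lemma dtm_sq_eq_add {m : ℝ} (hm : m ∈ Set.Ioo (0 : ℝ) 1) (q : ℝ) :
    dtm Q m x ^ 2 = (1 / m) * ((m * q - ∫ s in (0 : ℝ)..q, sqDistCDF Q x s)
      + ∫ s in q..quantile (sqDistCDF Q x) m, (m - sqDistCDF Q x s)) := by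
  have hint (a b : ℝ) : IntervalIntegrable (fun s ↦ m - sqDistCDF Q x s) volume a b :=
    intervalIntegrable_const.sub (intervalIntegrable_sqDistCDF Q x a b)
  rw [dtm_sq Q x hm, ← intervalIntegral.integral_add_adjacent_intervals (hint 0 q) (hint _ _),
    intervalIntegral.integral_sub intervalIntegrable_const (intervalIntegrable_sqDistCDF Q x _ _),
    intervalIntegral.integral_const, smul_eq_mul, sub_zero, mul_comm q m]

/-! ### Moments of the truncated squared distance. -/

/-- Layer cake: max(q - r, 0) = ∫₀^q 1{r ≤ s} ds for r ≥ 0. The weight `h` lets the second moment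
follow from two applications. -/
lemma integral_mul_max_sub {q : ℝ} (hq : 0 ≤ q) {h : EuclideanSpace ℝ (Fin d) → ℝ}
    (hh : Integrable h Q) :
    ∫ y, h y * max (q - ‖y - x‖ ^ 2) 0 ∂Q
      = ∫ s in (0 : ℝ)..q, ∫ y, h y * {y | ‖y - x‖ ^ 2 ≤ s}.indicator 1 y ∂Q := by
  have : IsFiniteMeasure (volume.restrict (Set.uIoc 0 q)) := by
    rw [Set.uIoc_of_le hq]
    infer_instance
  have hint : Integrable (Function.uncurry fun (s : ℝ) (y : EuclideanSpace ℝ (Fin d)) ↦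
      h y * {y | ‖y - x‖ ^ 2 ≤ s}.indicator (1 : EuclideanSpace ℝ (Fin d) → ℝ) y)
      ((volume.restrict (Set.uIoc 0 q)).prod Q) := by
    refine (hh.comp_snd (μ := volume.restrict (Set.uIoc 0 q))).mul_bdd (c := 1) ?_
      (ae_of_all _ fun p ↦ ?_)
    · exact (Measurable.ite (measurableSet_le (f := fun p : ℝ × EuclideanSpace ℝ (Fin d) ↦
        ‖p.2 - x‖ ^ 2) (g := Prod.fst) (by fun_prop) measurable_fst)
        measurable_const measurable_const).aestronglyMeasurable
    · by_cases hp : ‖p.2 - x‖ ^ 2 ≤ p.1 <;> simp [hp]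
  rw [intervalIntegral_integral_swap hint]
  refine integral_congr_ae (ae_of_all _ fun y ↦ ?_)
  simp only
  rw [intervalIntegral.integral_const_mul, intervalIntegral.integral_of_le hq]
  congr 1
  have hset : (Set.Ici (‖y - x‖ ^ 2) ∩ Set.Ioc 0 q : Set ℝ) =ᵐ[volume]
      (Set.Ioc (‖y - x‖ ^ 2) q : Set ℝ) := by
    rcases (sq_nonneg ‖y - x‖).eq_or_lt with h0 | h0
    · have : Set.Ici (‖y - x‖ ^ 2) ∩ Set.Ioc 0 q = Set.Ioc (‖y - x‖ ^ 2) q := by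
        ext s
        simp only [← h0, Set.mem_inter_iff, Set.mem_Ici, Set.mem_Ioc]
        exact ⟨fun h ↦ h.2, fun h ↦ ⟨h.1.le, h⟩⟩
      exact this ▸ EventuallyEq.rfl
    · have : Set.Ici (‖y - x‖ ^ 2) ∩ Set.Ioc 0 q = Set.Icc (‖y - x‖ ^ 2) q := by
        ext s
        simp only [Set.mem_inter_iff, Set.mem_Ici, Set.mem_Ioc, Set.mem_Icc]
        exact ⟨fun h ↦ ⟨h.1, h.2.2⟩, fun h ↦ ⟨h.1, h0.trans_le h.1, h.2⟩⟩
      rw [this]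
      exact Ioc_ae_eq_Icc.symm
  have := integral_indicator_one (μ := volume.restrict (Set.Ioc 0 q))
    (measurableSet_Ici (a := ‖y - x‖ ^ 2))
  simp only [Set.indicator_apply, Set.mem_Ici, Pi.one_apply] at this
  simp only [Set.indicator_apply, Set.mem_ofPred_eq, Pi.one_apply]
  rw [this, measureReal_restrict_apply measurableSet_Ici, measureReal_congr hset,
    Real.volume_real_Ioc]

lemma abs_max_sub_le {q : ℝ} (hq : 0 ≤ q) (y : EuclideanSpace ℝ (Fin d)) :
    |max (q - ‖y - x‖ ^ 2) 0| ≤ q := by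
  rw [abs_of_nonneg (le_max_right _ _)]
  exact max_le (sub_le_self _ (sq_nonneg _)) hq

lemma integrable_max_sub {q : ℝ} (hq : 0 ≤ q) :
    Integrable (fun y ↦ max (q - ‖y - x‖ ^ 2) 0) Q :=
  Integrable.of_bound (by fun_prop) q (ae_of_all _ (abs_max_sub_le x hq))

lemma memLp_max_sub {q : ℝ} (hq : 0 ≤ q) :
    MemLp (fun y ↦ max (q - ‖y - x‖ ^ 2) 0) 2 Q :=
  MemLp.of_bound (by fun_prop) q (ae_of_all _ (abs_max_sub_le x hq))

lemma integral_max_sub {q : ℝ} (hq : 0 ≤ q) :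
    ∫ y, max (q - ‖y - x‖ ^ 2) 0 ∂Q = ∫ s in (0 : ℝ)..q, sqDistCDF Q x s := by
  have := integral_mul_max_sub Q x hq (h := fun _ ↦ 1) (integrable_const _)
  simpa only [one_mul, integral_indicator_sqDist_le] using this

lemma integral_max_sub_sq {q : ℝ} (hq : 0 ≤ q) :
    ∫ y, max (q - ‖y - x‖ ^ 2) 0 ^ 2 ∂Q
      = ∫ t in (0 : ℝ)..q, ∫ s in (0 : ℝ)..q, sqDistCDF Q x (min s t) := by
  simp_rw [pow_two (max _ _)]
  rw [integral_mul_max_sub Q x hq (integrable_max_sub Q x hq)]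
  congr 1 with t
  simp_rw [mul_comm (max _ _)]
  have hind : Integrable ({y : EuclideanSpace ℝ (Fin d) | ‖y - x‖ ^ 2 ≤ t}.indicator
      (1 : EuclideanSpace ℝ (Fin d) → ℝ)) Q :=
    (integrable_const 1).indicator (measurableSet_sqDist_le x t)
  rw [integral_mul_max_sub Q x hq hind]
  congr 1 with s
  rw [← integral_indicator_sqDist_le]
  congr 1 with y
  by_cases h1 : ‖y - x‖ ^ 2 ≤ t <;> by_cases h2 : ‖y - x‖ ^ 2 ≤ s <;> simp [h1, h2]

lemma asympVariance_eq {m : ℝ} (hm : m ∈ Set.Ioo (0 : ℝ) 1) :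
    asympVariance Q m x = (1 / m ^ 2) *
      Var[fun y ↦ max (quantile (sqDistCDF Q x) m - ‖y - x‖ ^ 2) 0; Q] := by
  have hmono := sqDistCDF_mono Q x
  set q := quantile (sqDistCDF Q x) m
  have hq : 0 ≤ q := quantile_nonneg Q x hm
  have hmin (t : ℝ) : IntervalIntegrable (fun s ↦ sqDistCDF Q x (min s t)) volume 0 q :=
    Monotone.intervalIntegrable fun a b hab ↦ hmono (min_le_min_right t hab)
  have hmin' : IntervalIntegrable (fun t ↦ ∫ s in (0 : ℝ)..q, sqDistCDF Q x (min s t))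
      volume 0 q :=
    Monotone.intervalIntegrable fun a b hab ↦ intervalIntegral.integral_mono hq (hmin a) (hmin b)
      fun s ↦ hmono (min_le_min_left s hab)
  have hF := intervalIntegrable_sqDistCDF Q x 0 q
  rw [asympVariance, variance_eq_sub (memLp_max_sub Q x hq), integral_max_sub Q x hq]
  simp only [Pi.pow_apply]
  rw [integral_max_sub_sq Q x hq, pow_two (∫ s in (0 : ℝ)..q, sqDistCDF Q x s),
    ← intervalIntegral.integral_mul_const, ← intervalIntegral.integral_sub hmin' (hF.mul_const _)]
  congr 2 with t
  rw [intervalIntegral.integral_sub (hmin t) (hF.mul_const _),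
    intervalIntegral.integral_mul_const, mul_comm (sqDistCDF Q x t)]

end DistToMeasure

namespace DistToMeasure

variable {d : ℕ}

/-! ### Empirical measures and measurability. -/

section Empirical

variable {n : ℕ}

lemma isProbabilityMeasure_empiricalMeasure (hn : n ≠ 0)
    (y : Fin n → EuclideanSpace ℝ (Fin d)) : IsProbabilityMeasure (empiricalMeasure y) := by
  refine ⟨?_⟩
  simp only [empiricalMeasure, Measure.smul_apply, Measure.finsetSum_apply, measure_univ,
    Finset.sum_const, Finset.card_univ, Fintype.card_fin, nsmul_eq_mul, mul_one, smul_eq_mul]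
  exact ENNReal.inv_mul_cancel (by simpa using hn) (ENNReal.natCast_ne_top n)

lemma integral_empiricalMeasure (y : Fin n → EuclideanSpace ℝ (Fin d))
    (f : EuclideanSpace ℝ (Fin d) → ℝ) :
    ∫ z, f z ∂empiricalMeasure y = (n : ℝ)⁻¹ * ∑ i, f (y i) := by
  rw [empiricalMeasure, integral_smul_measure, integral_finsetSum_measure]
  · simp
  · exact fun i _ ↦ integrable_dirac (by simp)

lemma sqDistCDF_empiricalMeasure (x : EuclideanSpace ℝ (Fin d))
    (y : Fin n → EuclideanSpace ℝ (Fin d)) (t : ℝ) :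
    sqDistCDF (empiricalMeasure y) x t
      = (n : ℝ)⁻¹ *
        ∑ i, {z | ‖z - x‖ ^ 2 ≤ t}.indicator (1 : EuclideanSpace ℝ (Fin d) → ℝ) (y i) := by
  rw [← integral_indicator_sqDist_le, integral_empiricalMeasure]

lemma measurable_dtm_empiricalMeasure_sq (x : EuclideanSpace ℝ (Fin d)) {m : ℝ}
    (hm : m ∈ Set.Ioo (0 : ℝ) 1) :
    Measurable fun y : Fin n → EuclideanSpace ℝ (Fin d) ↦ dtm (empiricalMeasure y) m x ^ 2 := by
  rcases eq_or_ne n 0 with rfl | hn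
  · exact Subsingleton.measurable
  have hprob := isProbabilityMeasure_empiricalMeasure (d := d) hn
  have hq : Measurable fun y : Fin n → EuclideanSpace ℝ (Fin d) ↦
      quantile (sqDistCDF (empiricalMeasure y) x) m := by
    refine measurable_of_Iic fun t ↦ ?_
    have : (fun y : Fin n → EuclideanSpace ℝ (Fin d) ↦
        quantile (sqDistCDF (empiricalMeasure y) x) m) ⁻¹' Set.Iic t
        = {y | m ≤ sqDistCDF (empiricalMeasure y) x t} := by
      ext y
      exact quantile_le_iff _ x hm t
    rw [this]
    simp_rw [sqDistCDF_empiricalMeasure]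
    refine measurableSet_le measurable_const (measurable_const.mul ?_)
    exact Finset.measurable_sum _ fun i _ ↦
      (measurable_one.indicator (measurableSet_sqDist_le x t)).comp (measurable_pi_apply i)
  -- Cut at its own quantile, the expansion has no remainder and is an explicit function of
  -- measurable quantities.
  have heq (y : Fin n → EuclideanSpace ℝ (Fin d)) : dtm (empiricalMeasure y) m x ^ 2
      = (1 / m) * (m * quantile (sqDistCDF (empiricalMeasure y) x) m
        - (n : ℝ)⁻¹ * ∑ i, max (quantile (sqDistCDF (empiricalMeasure y) x) m
          - ‖y i - x‖ ^ 2) 0) := by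
    rw [dtm_sq_eq_add _ x hm (quantile (sqDistCDF (empiricalMeasure y) x) m),
      intervalIntegral.integral_same, add_zero, ← integral_max_sub _ x (quantile_nonneg _ x hm),
      integral_empiricalMeasure]
  simp_rw [heq]
  fun_prop

end Empirical

/-! ### Chebyshev bounds and consistency of the quantile. -/

section Probability

variable {Ω : Type*} [MeasurableSpace Ω] {μ : Measure Ω} [IsProbabilityMeasure μ]

/-- The product of a sequence converging to zero in probability and a sequence whose tails are
uniformly of order two converges to zero in probability. -/
lemma tendstoInMeasure_mul_zero {U V : ℕ → Ω → ℝ} {K : ℝ} (hU : TendstoInMeasure μ U atTop 0)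
    (hV : ∀ᶠ n in atTop, ∀ c > 0, μ.real {ω | c ≤ |V n ω|} ≤ K / c ^ 2) :
    TendstoInMeasure μ (U * V) atTop 0 := by
  rw [tendstoInMeasure_iff_measureReal_norm] at hU ⊢
  simp only [Pi.zero_apply, sub_zero, Real.norm_eq_abs, Pi.mul_apply] at hU ⊢
  intro ε hε
  refine tendsto_order.2 ⟨fun a ha ↦ .of_forall fun n ↦ ha.trans_le measureReal_nonneg,
    fun δ hδ ↦ ?_⟩
  have hK : Tendsto (fun c : ℝ ↦ K / c ^ 2) atTop (nhds 0) :=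
    tendsto_const_nhds.div_atTop (tendsto_pow_atTop two_ne_zero)
  obtain ⟨c, hcK, hc⟩ := ((hK.eventually (gt_mem_nhds (half_pos hδ))).and
    (eventually_gt_atTop 0)).exists
  filter_upwards [hV, (hU (ε / c) (by positivity)).eventually (gt_mem_nhds (half_pos hδ))]
    with n hVn hUn
  have hsub : {ω | ε ≤ |U n ω * V n ω|} ⊆ {ω | ε / c ≤ |U n ω|} ∪ {ω | c ≤ |V n ω|} := by
    intro ω hω
    by_contra! h
    simp only [Set.mem_union, Set.mem_ofPred_eq, not_or, not_le] at h hω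
    have := mul_lt_mul'' h.1 h.2 (abs_nonneg _) (abs_nonneg _)
    rw [div_mul_cancel₀ _ hc.ne', ← abs_mul] at this
    exact this.not_ge hω
  calc μ.real {ω | ε ≤ |U n ω * V n ω|}
      ≤ μ.real {ω | ε / c ≤ |U n ω|} + μ.real {ω | c ≤ |V n ω|} :=
        (measureReal_mono hsub).trans (measureReal_union_le _ _)
    _ < δ := by linarith [hVn c hc]

variable {P : Measure (EuclideanSpace ℝ (Fin d))} {X : ℕ → Ω → EuclideanSpace ℝ (Fin d)}

lemma measureReal_le_abs_average_sub_le (hlaw : ∀ i, HasLaw (X i) P μ) (hindep : iIndepFun X μ)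
    {f : EuclideanSpace ℝ (Fin d) → ℝ} (hf : Measurable f) (hf01 : ∀ y, f y ∈ Set.Icc (0 : ℝ) 1)
    {n : ℕ} (hn : n ≠ 0) {c : ℝ} (hc : 0 < c) :
    μ.real {ω | c ≤ |(n : ℝ)⁻¹ * ∑ i : Fin n, f (X i ω) - ∫ y, f y ∂P|} ≤ 1 / (n * c ^ 2) := by
  have hn0 : (0 : ℝ) < n := by exact_mod_cast hn.bot_lt
  have hX (i : ℕ) : AEMeasurable (X i) μ := (hlaw i).aemeasurable
  have hmem (i : ℕ) : MemLp (f ∘ X i) 2 μ := by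
    refine MemLp.of_bound (hf.comp_aemeasurable (hX i)).aestronglyMeasurable 1
      (ae_of_all _ fun ω ↦ ?_)
    rw [Real.norm_eq_abs, Function.comp_apply, abs_of_nonneg (hf01 _).1]
    exact (hf01 _).2
  have hint (i : ℕ) : ∫ ω, f (X i ω) ∂μ = ∫ y, f y ∂P :=
    (hlaw i).integral_comp hf.aestronglyMeasurable
  set S : Ω → ℝ := ∑ i ∈ Finset.range n, f ∘ X i with hS
  have hSapply (ω : Ω) : S ω = ∑ i : Fin n, f (X i ω) := by
    rw [Fin.sum_univ_eq_sum_range (fun i ↦ f (X i ω)) n]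
    simp [hS]
  have hSmem : MemLp S 2 μ := memLp_finsetSum' _ fun i _ ↦ hmem i
  have hSint : ∫ ω, S ω ∂μ = n * ∫ y, f y ∂P := by
    simp only [hS, Finset.sum_apply, Function.comp_apply]
    rw [integral_finsetSum (f := fun i ω ↦ f (X i ω)) _
      fun i _ ↦ (hmem i).integrable one_le_two]
    simp [hint]
  -- Each [0,1]-valued summand has variance at most 1/4; the crude bound 1 suffices.
  have hvar : Var[S; μ] ≤ n := by
    rw [IndepFun.variance_sum (fun i _ ↦ hmem i) fun i _ j _ hij ↦
      (hindep.indepFun hij).comp hf hf]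
    refine (Finset.sum_le_card_nsmul _ _ 1 fun i _ ↦ ?_).trans (by simp)
    refine (variance_le_sq_of_bounded (a := 0) (b := 1) (ae_of_all _ fun ω ↦ hf01 (X i ω))
      (hf.comp_aemeasurable (hX i))).trans (by norm_num)
  have hset : {ω | c ≤ |(n : ℝ)⁻¹ * ∑ i : Fin n, f (X i ω) - ∫ y, f y ∂P|}
      = {ω | n * c ≤ |S ω - ∫ ω, S ω ∂μ|} := by
    ext ω
    have : S ω - ∫ ω, S ω ∂μ = n * ((n : ℝ)⁻¹ * ∑ i : Fin n, f (X i ω) - ∫ y, f y ∂P) := by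
      rw [hSint, hSapply]
      field_simp
    rw [Set.mem_ofPred_eq, Set.mem_ofPred_eq, this, abs_mul, abs_of_pos hn0,
      mul_le_mul_iff_right₀ hn0]
  rw [hset]
  have hpos : 0 < n * c := by positivity
  calc μ.real {ω | n * c ≤ |S ω - ∫ ω, S ω ∂μ|} ≤ Var[S; μ] / (n * c) ^ 2 :=
        ENNReal.toReal_le_of_le_ofReal (div_nonneg (variance_nonneg _ _) (sq_nonneg _))
          (meas_ge_le_variance_div_sq hSmem hpos)
    _ ≤ n / (n * c) ^ 2 := by gcongr
    _ = 1 / (n * c ^ 2) := by field_simp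

lemma measureReal_le_abs_sqDistCDF_sub_le (hlaw : ∀ i, HasLaw (X i) P μ)
    (hindep : iIndepFun X μ) (x : EuclideanSpace ℝ (Fin d)) (t : ℝ) {n : ℕ} (hn : n ≠ 0)
    {c : ℝ} (hc : 0 < c) :
    μ.real {ω | c ≤ |sqDistCDF (empiricalMeasure fun i : Fin n ↦ X i ω) x t
      - sqDistCDF P x t|} ≤ 1 / (n * c ^ 2) := by
  have := measureReal_le_abs_average_sub_le hlaw hindep
    (measurable_one.indicator (measurableSet_sqDist_le x t)) (fun y ↦ ⟨?_, ?_⟩) hn hc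
  · rw [integral_indicator_sqDist_le] at this
    simpa only [sqDistCDF_empiricalMeasure] using this
  · exact Set.indicator_nonneg (fun _ _ ↦ zero_le_one) y
  · exact Set.indicator_le_self' (fun _ _ ↦ zero_le_one) y

lemma tendsto_measureReal_le_abs_sqDistCDF_sub (hlaw : ∀ i, HasLaw (X i) P μ)
    (hindep : iIndepFun X μ) (x : EuclideanSpace ℝ (Fin d)) (t : ℝ) {c : ℝ} (hc : 0 < c) :
    Tendsto (fun n : ℕ ↦ μ.real {ω | c ≤ |sqDistCDF (empiricalMeasure fun i : Fin n ↦ X i ω) x t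
      - sqDistCDF P x t|}) atTop (nhds 0) := by
  have h : Tendsto (fun n : ℕ ↦ 1 / (n * c ^ 2)) atTop (nhds 0) :=
    tendsto_const_nhds.div_atTop
      (tendsto_natCast_atTop_atTop.atTop_mul_const (by positivity))
  refine squeeze_zero' (.of_forall fun n ↦ measureReal_nonneg) ?_ h
  filter_upwards [eventually_ne_atTop 0] with n hn
  exact measureReal_le_abs_sqDistCDF_sub_le hlaw hindep x t hn hc

/-- Consistency of the empirical quantile at a point where the quantile is unique. -/
lemma tendstoInMeasure_quantile_empiricalMeasure (hlaw : ∀ i, HasLaw (X i) P μ)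
    (hindep : iIndepFun X μ) (x : EuclideanSpace ℝ (Fin d)) {m q : ℝ}
    (hm : m ∈ Set.Ioo (0 : ℝ) 1) (hlt : ∀ t < q, sqDistCDF P x t < m)
    (hgt : ∀ t, q < t → m < sqDistCDF P x t) :
    TendstoInMeasure μ (fun (n : ℕ) ω ↦
      quantile (sqDistCDF (empiricalMeasure fun i : Fin n ↦ X i ω) x) m - q) atTop 0 := by
  rw [tendstoInMeasure_iff_measureReal_norm]
  intro ε hε
  simp only [Pi.zero_apply, sub_zero, Real.norm_eq_abs]
  -- On the right the Galois connection needs a level strictly below the empirical quantile, hence ε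
  -- / 2; on the left a weak inequality is enough.
  have h1 := hgt (q + ε / 2) (by linarith)
  have h2 := hlt (q - ε) (by linarith)
  have hlim := (tendsto_measureReal_le_abs_sqDistCDF_sub hlaw hindep x (q + ε / 2)
    (sub_pos.2 h1)).add (tendsto_measureReal_le_abs_sqDistCDF_sub hlaw hindep x (q - ε)
    (sub_pos.2 h2))
  rw [add_zero] at hlim
  refine squeeze_zero' (.of_forall fun n ↦ measureReal_nonneg) ?_ hlim
  filter_upwards [eventually_ne_atTop 0] with n hn
  refine (measureReal_mono fun ω hω ↦ ?_).trans (measureReal_union_le _ _)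
  set Q := empiricalMeasure fun i : Fin n ↦ X i ω with hQ
  have : IsProbabilityMeasure Q := isProbabilityMeasure_empiricalMeasure hn _
  rw [Set.mem_ofPred_eq, le_abs'] at hω
  rcases hω with h | h
  · right
    have := (quantile_le_iff Q x hm (q - ε)).1 (by linarith)
    rw [Set.mem_ofPred_eq, ← hQ]
    exact le_trans (by linarith) (le_abs_self _)
  · left
    have := (lt_quantile_iff Q x hm (q + ε / 2)).1 (by linarith)
    rw [Set.mem_ofPred_eq, ← hQ]
    exact le_trans (by linarith) (neg_le_abs _)

end Probability

/-! ### Consequences of the derivative hypothesis. -/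

section UniqueQuantile

variable {P : Measure (EuclideanSpace ℝ (Fin d))} [IsProbabilityMeasure P]

lemma sqDistCDF_quantile {x : EuclideanSpace ℝ (Fin d)} {m : ℝ} (hm : m ∈ Set.Ioo (0 : ℝ) 1)
    (hcont : ContinuousAt (sqDistCDF P x) (quantile (sqDistCDF P x) m)) :
    sqDistCDF P x (quantile (sqDistCDF P x) m) = m := by
  refine le_antisymm ?_ ((quantile_le_iff P x hm _).1 le_rfl)
  refine le_of_tendsto (hcont.continuousWithinAt (s := Set.Iio (quantile (sqDistCDF P x) m))) ?_
  filter_upwards [self_mem_nhdsWithin] with s hs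
  exact ((lt_quantile_iff P x hm s).1 hs).le

/-- Some point of (a, b) has positive slope from `a`; monotonicity carries the strict inequality to
`b`. -/
lemma _root_.Monotone.lt_of_deriv_pos {f : ℝ → ℝ} (hf : Monotone f) {a b : ℝ} (hab : a < b)
    (hdiff : DifferentiableAt ℝ f a) (hpos : 0 < deriv f a) : f a < f b := by
  have h := (hasDerivAt_iff_tendsto_slope.1 hdiff.hasDerivAt).mono_left
    (nhdsWithin_mono a fun s (hs : s ∈ Set.Ioi a) ↦ hs.ne')
  obtain ⟨s, hs, hsb⟩ := ((h.eventually (lt_mem_nhds hpos)).and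
    (Ioo_mem_nhdsGT hab)).exists
  rw [slope_pos_iff_of_le hsb.1.le] at hs
  exact hs.trans_le (hf hsb.2.le)

end UniqueQuantile

end DistToMeasure

namespace DistToMeasure

/-- The linear part of the squared distance to a measure, evaluated at one observation. -/
noncomputable def influence {d : ℕ} (x : EuclideanSpace ℝ (Fin d)) (m q : ℝ)
    (y : EuclideanSpace ℝ (Fin d)) : ℝ :=
  -(1 / m) * max (q - ‖y - x‖ ^ 2) 0

/-! ### Influence function and linearization error. -/

section Influence

variable {d : ℕ} (x : EuclideanSpace ℝ (Fin d)) {m q : ℝ}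

lemma measurable_influence : Measurable (influence x m q) := by
  unfold influence
  fun_prop

variable (P : Measure (EuclideanSpace ℝ (Fin d))) [IsProbabilityMeasure P]

lemma memLp_influence (hq : 0 ≤ q) : MemLp (influence x m q) 2 P :=
  (memLp_max_sub P x hq).const_mul _

lemma integral_influence (hq : 0 ≤ q) :
    ∫ y, influence x m q y ∂P = -(1 / m) * ∫ s in (0 : ℝ)..q, sqDistCDF P x s := by
  unfold influence
  rw [integral_const_mul, integral_max_sub P x hq]

lemma variance_influence (hm : m ∈ Set.Ioo (0 : ℝ) 1) :
    Var[influence x m (quantile (sqDistCDF P x) m); P] = asympVariance P m x := by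
  unfold influence
  rw [variance_const_mul, asympVariance_eq P x hm, neg_sq, div_pow, one_pow]

/-- The linearization error of `√n (δ̂² - δ²)` is controlled by the product of the error of the
empirical quantile and the empirical process at the quantile. -/
lemma abs_sqrt_mul_dtm_sq_sub_sub_le (hm : m ∈ Set.Ioo (0 : ℝ) 1)
    {n : ℕ} (y : ℕ → EuclideanSpace ℝ (Fin d))
    (hq : quantile (sqDistCDF P x) m = q) :
    |√(n : ℝ) * (dtm (empiricalMeasure fun i : Fin n ↦ y i) m x ^ 2 - dtm P m x ^ 2)
      - (√(n : ℝ))⁻¹ * (∑ k ∈ Finset.range n, influence x m q (y k)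
        - n * ∫ z, influence x m q z ∂P)|
      ≤ |(quantile (sqDistCDF (empiricalMeasure fun i : Fin n ↦ y i) x) m - q)
        * (√(n : ℝ) * (1 / m) * (sqDistCDF (empiricalMeasure fun i : Fin n ↦ y i) x q - m))| := by
  rcases eq_or_ne n 0 with rfl | hn
  · simp
  have hm0 : 0 < m := hm.1
  have hq0 : 0 ≤ q := hq ▸ quantile_nonneg P x hm
  have hn0 : (0 : ℝ) < n := by exact_mod_cast hn.bot_lt
  have hs : 0 < √(n : ℝ) := Real.sqrt_pos.2 hn0
  set Q := empiricalMeasure fun i : Fin n ↦ y i with hQ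
  have : IsProbabilityMeasure Q := isProbabilityMeasure_empiricalMeasure hn _
  have hsum : ∑ k ∈ Finset.range n, influence x m q (y k)
      = n * (-(1 / m) * ∫ s in (0 : ℝ)..q, sqDistCDF Q x s) := by
    rw [← integral_influence x Q hq0, hQ, integral_empiricalMeasure,
      mul_inv_cancel_left₀ hn0.ne', ← Fin.sum_univ_eq_sum_range (fun k ↦ influence x m q (y k)) n]
  have hR := abs_integral_sub_sqDistCDF_le Q x hm q
  have hPeq := dtm_sq_eq_add P x hm q
  rw [hq, intervalIntegral.integral_same, add_zero] at hPeq
  rw [hsum, integral_influence x P hq0, dtm_sq_eq_add Q x hm q, hPeq]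
  generalize (∫ s in q..quantile (sqDistCDF Q x) m, (m - sqDistCDF Q x s)) = R at hR ⊢
  generalize (∫ s in (0 : ℝ)..q, sqDistCDF Q x s) = A
  generalize (∫ s in (0 : ℝ)..q, sqDistCDF P x s) = B
  have hsn : (√(n : ℝ))⁻¹ * n = √n := by
    rw [inv_mul_eq_div, Real.div_sqrt]
  have heq : √(n : ℝ) * (1 / m * (m * q - A + R) - 1 / m * (m * q - B))
      - (√(n : ℝ))⁻¹ * (n * (-(1 / m) * A) - n * (-(1 / m) * B)) = √n * (1 / m) * R := by
    linear_combination (A - B) * (1 / m) * hsn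
  rw [heq, abs_mul, abs_mul (_ - q), abs_mul (_ * _) (_ - m),
    abs_of_pos (by positivity : 0 < √(n : ℝ) * (1 / m))]
  calc √n * (1 / m) * |R| ≤ √n * (1 / m) * (_ * _) := by gcongr
    _ = _ := by ring

end Influence

/-! ### Tightness and the central limit theorem. -/

section Limit

variable {Ω : Type*} [MeasurableSpace Ω] {μ : Measure Ω} [IsProbabilityMeasure μ] {d : ℕ}
  {P : Measure (EuclideanSpace ℝ (Fin d))} {X : ℕ → Ω → EuclideanSpace ℝ (Fin d)}

lemma measureReal_le_abs_sqrt_mul_sqDistCDF_sub_le (hlaw : ∀ i, HasLaw (X i) P μ)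
    (hindep : iIndepFun X μ) (x : EuclideanSpace ℝ (Fin d)) {m : ℝ} (hm : 0 < m) (t : ℝ) {n : ℕ}
    (hn : n ≠ 0) {c : ℝ} (hc : 0 < c) :
    μ.real {ω | c ≤ |√(n : ℝ) * (1 / m) *
      (sqDistCDF (empiricalMeasure fun i : Fin n ↦ X i ω) x t - sqDistCDF P x t)|}
      ≤ 1 / m ^ 2 / c ^ 2 := by
  have hn0 : (0 : ℝ) < n := by exact_mod_cast hn.bot_lt
  have hs : 0 < √(n : ℝ) := Real.sqrt_pos.2 hn0
  have hc' : 0 < c * m / √n := by positivity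
  refine le_of_eq_of_le ?_
    ((measureReal_le_abs_sqDistCDF_sub_le hlaw hindep x t hn hc').trans_eq ?_)
  · congr 1 with ω
    rw [Set.mem_ofPred_eq, Set.mem_ofPred_eq, abs_mul, abs_of_pos (by positivity),
      div_le_iff₀ hs, mul_one_div, div_mul_eq_mul_div, le_div_iff₀ hm, mul_comm √(n : ℝ)]
  · rw [div_pow, Real.sq_sqrt hn0.le]
    field_simp

variable [IsProbabilityMeasure P]

lemma tendstoInDistribution_sum_influence (hlaw : ∀ i, HasLaw (X i) P μ) (hindep : iIndepFun X μ)
    (x : EuclideanSpace ℝ (Fin d)) {m : ℝ} (hm : m ∈ Set.Ioo (0 : ℝ) 1) :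
    TendstoInDistribution
      (fun (n : ℕ) (ω : Ω) ↦ (√(n : ℝ))⁻¹ *
        (∑ k ∈ Finset.range n, influence x m (quantile (sqDistCDF P x) m) (X k ω)
          - n * ∫ y, influence x m (quantile (sqDistCDF P x) m) y ∂P))
      atTop (id : ℝ → ℝ) (fun _ ↦ μ) (gaussianReal 0 (asympVariance P m x).toNNReal) := by
  set W := influence x m (quantile (sqDistCDF P x) m) with hW
  have hWmeas : Measurable W := measurable_influence x
  have hWmem : MemLp W 2 P := memLp_influence x P (quantile_nonneg P x hm)
  have hXm (i : ℕ) : AEMeasurable (X i) μ := (hlaw i).aemeasurable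
  have hvar : Var[W ∘ X 0; μ] = asympVariance P m x := by
    rw [← variance_influence x P hm, ← hW, ← (hlaw 0).map_eq,
      variance_map hWmeas.aemeasurable (hXm 0)]
  have hint : ∫ ω, (W ∘ X 0) ω ∂μ = ∫ y, W y ∂P :=
    (hlaw 0).integral_comp hWmeas.aestronglyMeasurable
  have hident (i : ℕ) : IdentDistrib (X i) (X 0) μ μ :=
    ⟨hXm i, hXm 0, (hlaw i).map_eq.trans (hlaw 0).map_eq.symm⟩
  have hclt := tendstoInDistribution_inv_sqrt_mul_sum_sub (X := fun i ↦ W ∘ X i) (P := μ)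
    (HasLaw.id (μ := gaussianReal 0 Var[W ∘ X 0; μ].toNNReal))
    ((memLp_map_measure_iff hWmeas.aestronglyMeasurable (hXm 0)).1
      ((hlaw 0).map_eq.symm ▸ hWmem)) (hindep.comp _ fun _ ↦ hWmeas)
    fun i ↦ (hident i).comp hWmeas
  rw [hint] at hclt
  simpa only [hvar, Function.comp_apply] using hclt

end Limit

end DistToMeasure

theorem mainTheorem1 {Ω : Type*} [MeasurableSpace Ω] (μ : Measure Ω) [IsProbabilityMeasure μ]
    {d : ℕ} (P : Measure (EuclideanSpace ℝ (Fin d))) [IsProbabilityMeasure P]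
    (X : ℕ → Ω → EuclideanSpace ℝ (Fin d))
    (hlaw : ∀ i, HasLaw (X i) P μ) (hindep : iIndepFun X μ)
    (x : EuclideanSpace ℝ (Fin d)) (m : ℝ) (hm : m ∈ Set.Ioo (0 : ℝ) 1)
    (hdiff : DifferentiableAt ℝ (DistToMeasure.sqDistCDF P x)
      (DistToMeasure.quantile (DistToMeasure.sqDistCDF P x) m))
    (hpos : 0 < deriv (DistToMeasure.sqDistCDF P x)
      (DistToMeasure.quantile (DistToMeasure.sqDistCDF P x) m)) :
    0 ≤ DistToMeasure.asympVariance P m x ∧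
    TendstoInDistribution
      (fun (n : ℕ) (ω : Ω) =>
        √(n : ℝ) * ((DistToMeasure.dtm
            (DistToMeasure.empiricalMeasure (fun i : Fin n => X i ω)) m x) ^ 2
          - (DistToMeasure.dtm P m x) ^ 2))
      atTop (id : ℝ → ℝ) (fun _ => μ)
      (gaussianReal 0 (DistToMeasure.asympVariance P m x).toNNReal) := by
  refine ⟨DistToMeasure.variance_influence x P hm ▸ variance_nonneg _ _, ?_⟩
  have hFq := DistToMeasure.sqDistCDF_quantile hm hdiff.continuousAt
  have hgt (t : ℝ) (ht : DistToMeasure.quantile (DistToMeasure.sqDistCDF P x) m < t) :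
      m < DistToMeasure.sqDistCDF P x t := by
    have := (DistToMeasure.sqDistCDF_mono P x).lt_of_deriv_pos ht hdiff hpos
    rwa [hFq] at this
  have hquant := DistToMeasure.tendstoInMeasure_quantile_empiricalMeasure hlaw hindep x hm
    (fun t ht ↦ (DistToMeasure.lt_quantile_iff P x hm t).1 ht) hgt
  have hclt := DistToMeasure.tendstoInDistribution_sum_influence hlaw hindep x hm
  have hmeas (n : ℕ) : AEMeasurable (fun ω ↦ √(n : ℝ) * ((DistToMeasure.dtm
      (DistToMeasure.empiricalMeasure (fun i : Fin n => X i ω)) m x) ^ 2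
        - (DistToMeasure.dtm P m x) ^ 2)) μ :=
    (((DistToMeasure.measurable_dtm_empiricalMeasure_sq x hm).comp_aemeasurable
      (aemeasurable_pi_lambda _ fun i : Fin n ↦ (hlaw i).aemeasurable)).sub_const _).const_mul _
  -- Slutsky: only the linearization error remains, to be dominated by a product of an o_P(1) and an
  -- O_P(1) factor.
  refine tendstoInDistribution_of_tendstoInMeasure_sub _ _ hclt ?_ hmeas
  have hprod := DistToMeasure.tendstoInMeasure_mul_zero hquant
    ((eventually_ne_atTop 0).mono fun n hn c hc ↦
      DistToMeasure.measureReal_le_abs_sqrt_mul_sqDistCDF_sub_le hlaw hindep x hm.1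
        (DistToMeasure.quantile (DistToMeasure.sqDistCDF P x) m) hn hc)
  rw [tendstoInMeasure_iff_measureReal_norm] at hprod ⊢
  intro ε hε
  have hle (n : ℕ) (ω : Ω) := DistToMeasure.abs_sqrt_mul_dtm_sq_sub_sub_le x P hm (n := n)
    (fun k ↦ X k ω) rfl
  refine squeeze_zero (fun n ↦ measureReal_nonneg) (fun n ↦ ?_) (hprod ε hε)
  refine measureReal_mono fun ω hω ↦ ?_
  simp only [Set.mem_ofPred_eq, Pi.zero_apply, sub_zero, Real.norm_eq_abs, Pi.mul_apply,
    Pi.sub_apply, hFq] at hω ⊢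
  exact hω.trans (hle n ω)
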